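/- A modulus of continuity is a continuous nondecreasing function $\rho:[0,1]\to[0,\infty)$ with $\rho(0)=0$ and $\rho(h)>0$ for $h\in(0,1]$. For $f\in C[0,1]$ let $|f|_\rho=\sup_{u\neq v}\frac{|f(u)-f(v)|}{\rho(|u-v|)}\in[0,\infty]$, the supremum being over $u,v\in[0,1]$. For two moduli of continuity write $\rho\gg\rho^*$ if $\rho^*(h)/\rho(h)\to 0$ as $h\downarrow 0$. Let $W_n$ ($n\in\mathbb{N}$) and $W$ be random elements of $C[0,1]$, each possibly defined on its own probability space, and let $\rho^*$ be a modulus of continuity such that $|W_n|_{\rho^*}<\infty$ almost surely for every $n$ and $|W|_{\rho^*}<\infty$ almost surely. Suppose that (i) the finite dimensional marginals of $W_n$ converge weakly to those of $W$, i.e. $(W_n(t_1),\dots,W_n(t_k))\Rightarrow (W(t_1),\dots,W(t_k))$ for all $k$ and $t_1,\dots,t_k\in[0,1]$; (ii) $|W_n|_{\rho^*}$ converges weakly to $|W|_{\rho^*}$ beyond some threshold $T\in\mathbb{R}$, i.e. $P(|W_n|_{\rho^*}>t)\to P(|W|_{\rho^*}>t)$ for every $t>T$ at which the distribution function of $|W|_{\rho^*}$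 is continuous. Then there exist a single probability space and random elements $\widetilde W_n$ ($n\in\mathbb{N}$), $\widetilde W$ of $C[0,1]$ defined on it such that $\widetilde W_n$ has the same law as $W_n$ for every $n$, $\widetilde W$ has the same law as $W$, and, simultaneously for every modulus of continuity $\rho\gg\rho^*$, $$|\widetilde W_n-\widetilde W|_{\rho}\to 0\quad\text{in probability as } n\to\infty .$$ -/

import Mathlib

open MeasureTheory ProbabilityTheory Filter Topology
open scoped ENNReal unitInterval

/-- A modulus of continuity on `[0,1]`: a continuous, nondecreasing function that vanishes at `0`
and is positive on `(0,1]`. Only the values on `[0,1]` matter. -/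
structure IsModulus (ρ : ℝ → ℝ) : Prop where
  continuousOn : ContinuousOn ρ (Set.Icc 0 1)
  monotoneOn : MonotoneOn ρ (Set.Icc 0 1)
  map_zero : ρ 0 = 0
  pos : ∀ h ∈ Set.Ioc (0 : ℝ) 1, 0 < ρ h

/-- `MuchLarger ρ ρ'` is the relation `ρ ≫ ρ'`: the quotient `ρ'(h) / ρ(h)` tends to `0` as
`h ↓ 0`. -/
def MuchLarger (ρ ρ' : ℝ → ℝ) : Prop :=
  Tendsto (fun h : ℝ => ρ' h / ρ h) (𝓝[>] 0) (𝓝 0)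

/-- The Hölder-type seminorm `|f|_ρ = sup_{u ≠ v} |f u - f v| / ρ |u - v|`, with values
in `[0, ∞]`. -/
noncomputable def holderSeminorm (ρ : ℝ → ℝ) (f : C(I, ℝ)) : ℝ≥0∞ :=
  ⨆ (u : I) (v : I) (_ : u ≠ v), ENNReal.ofReal (|f u - f v| / ρ |(u : ℝ) - (v : ℝ)|)

/-- Weak convergence of the finite dimensional marginals: for finitely many points
`t 1, …, t k` of `[0,1]`, the random vectors `(W n (t 1), …, W n (t k))` converge in distribution
to `(Z (t 1), …, Z (t k))`. Every process may live on its own probability space. -/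
def TendstoFidi {Ω : ℕ → Type*} {Ω' : Type*} [∀ n, MeasurableSpace (Ω n)] [MeasurableSpace Ω']
    (μ : ∀ n, Measure (Ω n)) [∀ n, IsProbabilityMeasure (μ n)]
    (ν : Measure Ω') [IsProbabilityMeasure ν]
    (W : ∀ n, Ω n → C(I, ℝ)) (Z : Ω' → C(I, ℝ)) : Prop :=
  ∀ (k : ℕ) (t : Fin k → I),
    TendstoInDistribution (fun n ω => fun i : Fin k => W n ω (t i)) atTop
      (fun ω => fun i : Fin k => Z ω (t i)) μ ν

/-- Weak convergence beyond the threshold `τ` of real random variables `X n` to `Y`: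
`P(X n > t) → P(Y > t)` for all `t > τ` at which the distribution function of `Y` is
continuous. -/
def TendstoBeyond (τ : ℝ) {Ω : ℕ → Type*} {Ω' : Type*} [∀ n, MeasurableSpace (Ω n)]
    [MeasurableSpace Ω'] (μ : ∀ n, Measure (Ω n)) (ν : Measure Ω')
    (X : ∀ n, Ω n → ℝ) (Y : Ω' → ℝ) : Prop :=
  ∀ t : ℝ, τ < t → ContinuousAt (fun s : ℝ => ν.real {ω | Y ω ≤ s}) t →
    Tendsto (fun n => (μ n).real {ω | t < X n ω}) atTop (𝓝 (ν.real {ω | t < Y ω}))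

/-
Two ideas combine. First, the sets `{f | |f|_ρ* > K}` are open for pointwise convergence, so
tightness of `|W_n|_ρ*` bounds the tail of `|W|_ρ*` as well; on `{|f|_ρ* ≤ K}` the values of `f`
on a fine finite grid control `sup |f|`, and `ρ ≫ ρ*` lets `sup |f|` control `|f|_ρ`. Hence it is
enough to couple the processes so that they converge in probability at each point of a countable
dense set.

Secondly, such a coupling exists for all evaluations at once. Partition `ℝ^k` into finitely many
cells, all but one of small diameter and the exceptional one of small mass, whose boundaries are
null for the law of the first `k` evaluations of `W`. For large `n` the cell masses of `W_n` are at
least `t` times those of `W`, with `t` close to `1`, so given `W` one can draw a path with the law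
of `W_n` that lies in the cell of `W` with probability at least `t`. Letting `k → ∞` slowly with `n`
and realising all these conditional laws from one uniform variable gives the probability space.
-/

open scoped NNReal

theorem tendsto_measure_Ici_atTop {α : Type*} [Preorder α] [Nonempty α]
    [NoMaxOrder α] [(atTop : Filter α).IsCountablyGenerated] [TopologicalSpace α]
    [ClosedIciTopology α] [MeasurableSpace α] [OpensMeasurableSpace α] (μ : Measure α)
    [IsFiniteMeasure μ] : Tendsto (fun a => μ (Set.Ici a)) atTop (𝓝 0) := by
  have hempty : ⋂ a : α, Set.Ici a = ∅ := Set.eq_empty_of_forall_notMem fun x hx =>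
    let ⟨a, ha⟩ := exists_gt x
    ha.not_ge (Set.mem_iInter.1 hx a)
  rw [← measure_empty (μ := μ), ← hempty]
  exact tendsto_measure_iInter_atTop (fun a => measurableSet_Ici.nullMeasurableSet)
    antitone_Ici ⟨Classical.arbitrary α, measure_ne_top _ _⟩

theorem notMem_frontier_iff {X : Type*} [TopologicalSpace X] {s : Set X} {x : X} :
    x ∉ frontier s ↔ ∀ᶠ z in 𝓝 x, (z ∈ s ↔ x ∈ s) := by
  rw [← Set.mem_compl_iff, compl_frontier_eq_union_interior, Set.mem_union,
    mem_interior_iff_mem_nhds, mem_interior_iff_mem_nhds]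
  by_cases hx : x ∈ s
  · have hx' : sᶜ ∉ 𝓝 x := fun h => mem_of_mem_nhds h hx
    simp only [hx, hx', or_false, iff_true, Filter.Eventually, Set.ofPred_mem_eq]
  · have hx' : s ∉ 𝓝 x := fun h => hx (mem_of_mem_nhds h)
    simp only [hx, hx', false_or, iff_false, Filter.Eventually, Set.compl_def]

open Classical in
theorem frontier_preimage_find_subset {X : Type*} [TopologicalSpace X] {B : ℕ → Set X}
    (hB : ∀ x, ∃ i, x ∈ B i) (s : Set ℕ) :
    frontier ((fun x => Nat.find (hB x)) ⁻¹' s) ⊆ ⋃ i, frontier (B i) := by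
  intro x hx
  by_contra hxB
  have hcell : ∀ i, ∀ᶠ z in 𝓝 x, (z ∈ B i ↔ x ∈ B i) := fun i =>
    notMem_frontier_iff.1 fun h => hxB (Set.mem_iUnion.2 ⟨i, h⟩)
  have hconst : ∀ᶠ z in 𝓝 x, Nat.find (hB z) = Nat.find (hB x) := by
    filter_upwards [(Set.finite_Iic (Nat.find (hB x))).eventually_all.2 fun i _ => hcell i]
      with z hz
    refine (Nat.find_eq_iff (hB z)).2 ⟨(hz _ (Set.mem_Iic.2 le_rfl)).2 (Nat.find_spec (hB x)),
      fun i hi hzi => ?_⟩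
    exact Nat.find_min (hB x) hi ((hz i hi.le).1 hzi)
  refine notMem_frontier_iff.2 ?_ hx
  filter_upwards [hconst] with z hz
  simp only [Set.mem_preimage, hz]

theorem exists_measurable_nat_dist_le {F : Type*} [PseudoMetricSpace F]
    [TopologicalSpace.SeparableSpace F] [MeasurableSpace F] [OpensMeasurableSpace F]
    (Q : Measure F) [SFinite Q] {δ : ℝ} (hδ : 0 < δ) :
    ∃ c : F → ℕ, Measurable c ∧ (∀ x y, c x = c y → dist x y ≤ δ) ∧
      ∀ s, Q (frontier (c ⁻¹' s)) = 0 := by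
  classical
  rcases isEmpty_or_nonempty F with hF | hF
  · exact ⟨fun _ => 0, measurable_const, fun x => hF.elim x, fun s => by
      simp only [Set.eq_empty_of_isEmpty, measure_empty]⟩
  let x : ℕ → F := TopologicalSpace.denseSeq F
  have hball : ∀ i, ∃ r ∈ Set.Ioo (δ / 4) (δ / 2), Q (frontier (Metric.ball (x i) r)) = 0 := by
    simpa only [Metric.thickening_singleton] using fun i =>
      exists_null_frontier_thickening Q {x i} (show δ / 4 < δ / 2 by linarith)
  choose r hr hnull using hball
  have hcover : ∀ y, ∃ i, y ∈ Metric.ball (x i) (r i) := fun y => by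
    obtain ⟨i, hi⟩ := (TopologicalSpace.denseRange_denseSeq F).exists_dist_lt y
      (show 0 < δ / 4 by linarith)
    exact ⟨i, hi.trans (hr i).1⟩
  refine ⟨fun y => Nat.find (hcover y),
    measurable_find hcover fun i => Metric.isOpen_ball.measurableSet, fun y z hyz => ?_, fun s =>
    measure_mono_null (frontier_preimage_find_subset hcover s) (measure_iUnion_null hnull)⟩
  have hy : dist y (x (Nat.find (hcover y))) < _ := Nat.find_spec (hcover y)
  have hz : dist z (x (Nat.find (hcover z))) < _ := Nat.find_spec (hcover z)
  dsimp only at hyz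
  rw [← hyz] at hz
  linarith [dist_triangle_right y z (x (Nat.find (hcover y))), (hr (Nat.find (hcover y))).2]

theorem exists_measurable_fin_dist_le {F : Type*} [PseudoMetricSpace F]
    [TopologicalSpace.SeparableSpace F] [MeasurableSpace F] [OpensMeasurableSpace F]
    (Q : Measure F) [IsFiniteMeasure Q] {δ : ℝ} (hδ : 0 < δ) {ε : ℝ≥0∞} (hε : 0 < ε) :
    ∃ (m : ℕ) (c : F → Fin (m + 1)), Measurable c ∧ (∀ s, Q (frontier (c ⁻¹' s)) = 0) ∧
      (∀ x y, c x = c y → c x ≠ Fin.last m → dist x y ≤ δ) ∧ Q (c ⁻¹' {Fin.last m}) ≤ ε := by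
  obtain ⟨c, hc, hdist, hnull⟩ := exists_measurable_nat_dist_le Q hδ
  obtain ⟨m, hm⟩ := (ENNReal.tendsto_nhds_zero.1 (tendsto_measure_Ici_atTop (Q.map c)) ε hε).exists
  rw [Measure.map_apply hc measurableSet_Ici] at hm
  have hlast : ∀ k, Fin.clamp k m = Fin.last m ↔ m ≤ k := fun k => by
    simp [Fin.ext_iff]
  refine ⟨m, fun x => Fin.clamp (c x) m, (measurable_from_nat (f := (Fin.clamp · m))).comp hc,
    fun s => hnull ((Fin.clamp · m) ⁻¹' s), fun x y hxy hx => hdist x y ?_, ?_⟩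
  · have hy := hxy ▸ hx
    simp only [ne_eq, hlast, not_le] at hx hy
    simpa [Fin.ext_iff, hx.le, hy.le] using hxy
  · refine (measure_mono fun x hx => ?_).trans hm
    exact (hlast _).1 hx

theorem ae_ae_condDistrib_id_eq {E ι : Type*} [MeasurableSpace E] [StandardBorelSpace E]
    [Nonempty E] [MeasurableSpace ι] [MeasurableEq ι] (P : Measure E) [IsFiniteMeasure P]
    {c : E → ι} (hc : Measurable c) :
    ∀ᵐ j ∂P.map c, ∀ᵐ w ∂condDistrib id c P j, c w = j := by
  refine Measure.ae_ae_of_ae_compProd (p := fun p => c p.2 = p.1) ?_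
  have hdiag : MeasurableSet {p : ι × E | c p.2 = p.1} :=
    measurableSet_eq_fun (hc.comp measurable_snd) measurable_fst
  rw [compProd_map_condDistrib aemeasurable_id, ae_map_iff (by fun_prop) hdiag]
  exact ae_of_all _ fun w => rfl

theorem exists_kernel_comp_eq_le_of_smul_comp_le {A B : Type*} [MeasurableSpace A]
    [MeasurableSpace B] {Q : Measure A} [IsProbabilityMeasure Q] {P : Measure B}
    [IsProbabilityMeasure P] (η : Kernel A B) [IsMarkovKernel η] {t : ℝ≥0∞}
    (h : t • (η ∘ₘ Q) ≤ P) :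
    ∃ κ : Kernel A B, IsMarkovKernel κ ∧ κ ∘ₘ Q = P ∧ ∀ a s, κ a s ≤ t * η a s + (1 - t) := by
  let R : Measure B := t • (η ∘ₘ Q)
  have : IsFiniteMeasure R := isFiniteMeasure_of_le P h
  have hR : R Set.univ = t := by simp [R]
  have hPR : (P - R) Set.univ = 1 - t := by
    rw [Measure.sub_apply .univ h, hR, measure_univ]
  have ht : t ≤ 1 := hR.ge.trans ((h _).trans_eq measure_univ)
  -- With probability `t` sample from `η a`; the deficit `P - R` restores the mean law `P`.
  let κ : Kernel A B :=
    ⟨fun a => t • η a + (P - R), Measure.measurable_of_measurable_coe _ fun s hs =>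
      ((η.measurable_coe hs).const_mul t).add_const _⟩
  refine ⟨κ, ⟨fun a => ⟨?_⟩⟩, ?_, fun a s => ?_⟩
  · change t * η a Set.univ + (P - R) Set.univ = 1
    rw [measure_univ, mul_one, hPR, add_tsub_cancel_of_le ht]
  · ext s hs
    calc (κ ∘ₘ Q) s = ∫⁻ a, t * η a s + (P - R) s ∂Q := Measure.bind_apply hs κ.aemeasurable
      _ = t * ∫⁻ a, η a s ∂Q + (P - R) s := by
        rw [lintegral_add_right _ measurable_const, lintegral_const, measure_univ, mul_one,
          lintegral_const_mul _ (η.measurable_coe hs)]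
      _ = R s + (P - R) s := by rw [← Measure.bind_apply hs η.aemeasurable]; rfl
      _ = P s := by rw [add_comm, ← Measure.add_apply, Measure.sub_add_cancel_of_le h]
  · exact add_le_add_right ((measure_mono (Set.subset_univ s)).trans_eq hPR) _

theorem exists_kernel_comp_eq_ae_ne_le {E ι : Type*} [MeasurableSpace E] [StandardBorelSpace E]
    [MeasurableSpace ι] [MeasurableEq ι] (P Q : Measure E) [IsProbabilityMeasure P]
    [IsProbabilityMeasure Q] {c : E → ι} (hc : Measurable c) {t : ℝ≥0∞}
    (h : t • Q.map c ≤ P.map c) :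
    ∃ κ : Kernel E E, IsMarkovKernel κ ∧ κ ∘ₘ Q = P ∧ ∀ᵐ z ∂Q, κ z {w | c w ≠ c z} ≤ 1 - t := by
  have : Nonempty E := nonempty_of_isProbabilityMeasure P
  let η : Kernel ι E := condDistrib id c P
  have hηQ : t • (η.comap c hc ∘ₘ Q) ≤ P := by
    refine Measure.le_iff.2 fun s hs => ?_
    calc (t • (η.comap c hc ∘ₘ Q)) s = (η ∘ₘ (t • Q.map c)) s := by
          rw [Measure.comp_smul, ← Kernel.comp_deterministic_eq_comap, ← Measure.comp_assoc,
            Measure.deterministic_comp_eq_map]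
      _ ≤ (η ∘ₘ P.map c) s := by
          simp only [Measure.bind_apply hs η.aemeasurable]
          exact lintegral_mono' h le_rfl
      _ = P s := by rw [condDistrib_comp_map hc.aemeasurable aemeasurable_id, Measure.map_id]
  obtain ⟨κ, hκ, hκP, hκη⟩ := exists_kernel_comp_eq_le_of_smul_comp_le (η.comap c hc) hηQ
  have hfibre : ∀ᵐ j ∂Q.map c, t * η j {w | c w ≠ j} = 0 := by
    rcases eq_or_ne t 0 with rfl | ht0
    · exact ae_of_all _ fun j => zero_mul _
    have hac : Q.map c ≪ P.map c :=
      (Measure.absolutelyContinuous_smul ht0).trans (Measure.absolutelyContinuous_of_le h)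
    filter_upwards [hac (ae_ae_condDistrib_id_eq P hc)] with j hj
    rw [ae_iff.1 hj, mul_zero]
  refine ⟨κ, hκ, hκP, ?_⟩
  filter_upwards [ae_of_ae_map hc.aemeasurable hfibre] with z hz
  calc κ z {w | c w ≠ c z} ≤ t * η (c z) {w | c w ≠ c z} + (1 - t) := hκη z _
    _ = 1 - t := by rw [hz, zero_add]

theorem eventually_smul_map_le_map {α F ι : Type*} {l : Filter α} {Ω : α → Type*} {Ω' : Type*}
    [∀ a, MeasurableSpace (Ω a)] [MeasurableSpace Ω'] {μ : ∀ a, Measure (Ω a)}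
    [∀ a, IsProbabilityMeasure (μ a)] {ν : Measure Ω'} [IsProbabilityMeasure ν]
    [TopologicalSpace F] [HasOuterApproxClosed F] [MeasurableSpace F] [OpensMeasurableSpace F]
    {X : ∀ a, Ω a → F} {Z : Ω' → F} (h : TendstoInDistribution X l Z μ ν)
    [Finite ι] [MeasurableSpace ι] {c : F → ι} (hc : Measurable c)
    (hnull : ∀ s, ν.map Z (frontier (c ⁻¹' s)) = 0) {t : ℝ≥0∞} (ht : t < 1) :
    ∀ᶠ a in l, t • (ν.map Z).map c ≤ ((μ a).map (X a)).map c := by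
  have hcell : ∀ s : Set ι, ∀ᶠ a in l,
      t * ν.map Z (c ⁻¹' s) ≤ (μ a).map (X a) (c ⁻¹' s) := fun s => by
    have hlim := ProbabilityMeasure.tendsto_measure_of_null_frontier_of_tendsto' h.tendsto (hnull s)
    rcases eq_or_ne (ν.map Z (c ⁻¹' s)) 0 with h0 | h0
    · simp [h0]
    · have hlt : t * ν.map Z (c ⁻¹' s) < ν.map Z (c ⁻¹' s) := by
        simpa only [one_mul] using (ENNReal.mul_lt_mul_iff_left h0 (measure_ne_top _ _)).2 ht
      exact (hlim.eventually (lt_mem_nhds hlt)).mono fun a ha => ha.le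
  filter_upwards [eventually_all.2 hcell] with a ha
  refine Measure.le_iff.2 fun s hs => ?_
  simpa only [Measure.smul_apply, smul_eq_mul, Measure.map_apply hc hs] using ha s

theorem eventually_exists_kernel_dist_le {α E F : Type*} {l : Filter α} [MeasurableSpace E]
    [StandardBorelSpace E] [PseudoMetricSpace F] [SecondCountableTopology F]
    [MeasurableSpace F] [OpensMeasurableSpace F] {P : α → Measure E} {Q : Measure E}
    [∀ a, IsProbabilityMeasure (P a)] [IsProbabilityMeasure Q] {g : E → F} (hg : Measurable g)
    (h : TendstoInDistribution (fun _ => g) l g P Q) {δ : ℝ} (hδ : 0 < δ) {ε : ℝ≥0∞}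
    (hε : 0 < ε) :
    ∀ᶠ a in l, ∃ κ : Kernel E E, IsMarkovKernel κ ∧ κ ∘ₘ Q = P a ∧
      (Q ⊗ₘ κ) {p | δ < dist (g p.1) (g p.2)} ≤ ε := by
  have : IsProbabilityMeasure (Q.map g) := Measure.isProbabilityMeasure_map hg.aemeasurable
  have hε2 : 0 < ε / 2 := ENNReal.half_pos hε.ne'
  obtain ⟨m, c, hc, hnull, hdist, hlast⟩ := exists_measurable_fin_dist_le (Q.map g) hδ hε2
  rw [Measure.map_apply hg (hc (measurableSet_singleton _))] at hlast
  have ht : 1 - ε / 2 < 1 := ENNReal.sub_lt_self ENNReal.one_ne_top one_ne_zero hε2.ne'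
  filter_upwards [eventually_smul_map_le_map h hc hnull ht] with a ha
  rw [Measure.map_map hc hg, Measure.map_map hc hg] at ha
  obtain ⟨κ, hκ, hκP, hκc⟩ := exists_kernel_comp_eq_ae_ne_le (P a) Q (hc.comp hg) ha
  refine ⟨κ, hκ, hκP, ?_⟩
  let L : Set E := (c ∘ g) ⁻¹' {Fin.last m}
  have hL : MeasurableSet L := hc.comp hg (measurableSet_singleton _)
  have hfibre : ∀ᵐ z ∂Q, κ z {w | δ < dist (g z) (g w)} ≤ ε / 2 + L.indicator 1 z := by
    filter_upwards [hκc] with z hz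
    by_cases hzL : z ∈ L
    · rw [Set.indicator_of_mem hzL]
      exact prob_le_one.trans le_add_self
    · refine (measure_mono fun w hw hwz => ?_).trans
        (hz.trans (tsub_tsub_le.trans le_self_add))
      exact hw.not_ge (hdist _ _ hwz.symm hzL)
  calc (Q ⊗ₘ κ) {p | δ < dist (g p.1) (g p.2)}
      = ∫⁻ z, κ z {w | δ < dist (g z) (g w)} ∂Q :=
        Measure.compProd_apply (measurableSet_lt measurable_const (by fun_prop))
    _ ≤ ∫⁻ z, ε / 2 + L.indicator 1 z ∂Q := lintegral_mono_ae hfibre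
    _ = ε / 2 + Q L := by
      rw [lintegral_add_left measurable_const, lintegral_const, measure_univ, mul_one,
        lintegral_indicator_one hL]
    _ ≤ ε := (add_le_add_right hlast _).trans_eq (ENNReal.add_halves ε)

theorem exists_tendsto_atTop_of_forall_eventually {p : ℕ → ℕ → Prop} (h0 : ∀ n, p n 0)
    (h : ∀ k, ∀ᶠ n in atTop, p n k) :
    ∃ k : ℕ → ℕ, Tendsto k atTop atTop ∧ ∀ n, p n (k n) := by
  classical
  refine ⟨fun n => Nat.findGreatest (p n) n, tendsto_atTop.2 fun k => ?_,
    fun n => Nat.findGreatest_spec (Nat.zero_le n) (h0 n)⟩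
  filter_upwards [h k, eventually_ge_atTop k] with n hn hkn using Nat.le_findGreatest hkn hn

theorem exists_map_prodMk_eq_compProd {ι A B : Type*} [MeasurableSpace A] [MeasurableSpace B]
    [StandardBorelSpace B] [Nonempty B] (Q : Measure A) [IsProbabilityMeasure Q]
    (κ : ι → Kernel A B) [∀ i, IsMarkovKernel (κ i)] :
    ∃ f : ι → A × I → B, (∀ i, Measurable (f i)) ∧
      ∀ i, (Q.prod ℙ).map (fun s => (s.1, f i s)) = Q ⊗ₘ κ i := by
  choose f hf hlaw using fun i => (κ i).exists_measurable_map_eq_unitInterval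
  refine ⟨fun i => Function.uncurry (f i), hf, fun i => ?_⟩
  ext s hs
  rw [Measure.map_apply (measurable_fst.prodMk (hf i)) hs, Measure.compProd_apply hs,
    Measure.prod_apply (measurable_fst.prodMk (hf i) hs)]
  refine lintegral_congr fun a => ?_
  have hfa : Measurable (f i a) := (hf i).comp measurable_prodMk_left
  rw [← hlaw i a, Measure.map_apply hfa (measurable_prodMk_left hs)]
  rfl

section Skorokhod

variable {E : Type*} {F : Type*} [MeasurableSpace E] [StandardBorelSpace E] [PseudoMetricSpace F]
  [SecondCountableTopology F] [MeasurableSpace F] [OpensMeasurableSpace F]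
  {P : ℕ → Measure E} {Q : Measure E} [∀ n, IsProbabilityMeasure (P n)] [IsProbabilityMeasure Q]
  {e : ℕ → E → F}

theorem exists_kernel_tendsto_compProd_dist (he : ∀ i, Measurable (e i))
    (h : ∀ k, TendstoInDistribution (fun _ x (i : Fin k) => e i x) atTop
      (fun x (i : Fin k) => e i x) P Q) :
    ∃ κ : ℕ → Kernel E E, (∀ n, IsMarkovKernel (κ n)) ∧ (∀ n, κ n ∘ₘ Q = P n) ∧
      ∀ i, ∀ δ > 0,
        Tendsto (fun n => (Q ⊗ₘ κ n) {p | δ ≤ dist (e i p.1) (e i p.2)}) atTop (𝓝 0) := by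
  obtain ⟨k, hk, hκ⟩ := exists_tendsto_atTop_of_forall_eventually
    (p := fun n k => ∃ κ : Kernel E E, IsMarkovKernel κ ∧ κ ∘ₘ Q = P n ∧ ∀ i : Fin k,
      (Q ⊗ₘ κ) {p | 1 / ((k : ℝ) + 1) < dist (e i p.1) (e i p.2)} ≤ (k : ℝ≥0∞)⁻¹)
    (fun n => ⟨Kernel.const E (P n), inferInstance, by simp, fun i => i.elim0⟩) fun k => by
      filter_upwards [eventually_exists_kernel_dist_le (by fun_prop) (h k)
        (show 0 < 1 / ((k : ℝ) + 1) by positivity)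
        (ENNReal.inv_pos.2 (ENNReal.natCast_ne_top k))] with n ⟨κ, hκ, hκP, hκd⟩
      exact ⟨κ, hκ, hκP, fun i => (measure_mono fun p hp => hp.trans_le
        (dist_le_pi_dist (fun i : Fin k => e i p.1) (fun i => e i p.2) i)).trans hκd⟩
  choose κ hκ hκP hκd using hκ
  refine ⟨κ, hκ, hκP, fun i δ hδ => ?_⟩
  refine tendsto_of_tendsto_of_tendsto_of_le_of_le' tendsto_const_nhds
    (ENNReal.tendsto_inv_nat_nhds_zero.comp hk) (Eventually.of_forall fun n => zero_le) ?_
  filter_upwards [hk.eventually_gt_atTop i,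
    (tendsto_one_div_add_atTop_nhds_zero_nat.comp hk).eventually (gt_mem_nhds hδ)] with n hi hn
  exact (measure_mono fun p hp => hn.trans_le hp).trans (hκd n ⟨i, hi⟩)

theorem exists_measurable_map_eq_tendstoInMeasure (he : ∀ i, Measurable (e i))
    (h : ∀ k, TendstoInDistribution (fun _ x (i : Fin k) => e i x) atTop
      (fun x (i : Fin k) => e i x) P Q) :
    ∃ (X : ℕ → E × I → E) (Y : E × I → E), (∀ n, Measurable (X n)) ∧ Measurable Y ∧
      (∀ n, (Q.prod ℙ).map (X n) = P n) ∧ (Q.prod ℙ).map Y = Q ∧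
      ∀ i, TendstoInMeasure (Q.prod ℙ) (fun n s => e i (X n s)) atTop (fun s => e i (Y s)) := by
  have : Nonempty E := nonempty_of_isProbabilityMeasure Q
  obtain ⟨κ, hκ, hκP, hκd⟩ := exists_kernel_tendsto_compProd_dist he h
  obtain ⟨X, hX, hlaw⟩ := exists_map_prodMk_eq_compProd Q κ
  refine ⟨X, Prod.fst, hX, measurable_fst, fun n => ?_, Measure.fst_prod, fun i => ?_⟩
  · rw [← hκP n, ← Measure.snd_compProd, ← hlaw n, Measure.snd_map_prodMk measurable_fst]
  · refine tendstoInMeasure_iff_dist.2 fun δ hδ => ?_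
    refine (hκd i δ hδ).congr fun n => ?_
    rw [← hlaw n, Measure.map_apply (measurable_fst.prodMk (hX n))
      (measurableSet_le measurable_const (by fun_prop))]
    simp only [Set.preimage_ofPred_eq, dist_comm]

end Skorokhod

theorem lowerSemicontinuous_holderSeminorm (ρ : ℝ → ℝ) :
    LowerSemicontinuous (holderSeminorm ρ) :=
  lowerSemicontinuous_iSup fun u => lowerSemicontinuous_iSup fun v =>
    lowerSemicontinuous_iSup fun _ =>
      Continuous.lowerSemicontinuous (ENNReal.continuous_ofReal.comp (by fun_prop))

theorem measurableSet_lt_holderSeminorm [MeasurableSpace C(I, ℝ)] [BorelSpace C(I, ℝ)]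
    (ρ : ℝ → ℝ) (K : ℝ≥0∞) : MeasurableSet {f : C(I, ℝ) | K < holderSeminorm ρ f} :=
  ((lowerSemicontinuous_holderSeminorm ρ).isOpen_preimage K).measurableSet

theorem unitInterval_abs_sub_mem_Ioc {u v : I} (h : u ≠ v) :
    |(u : ℝ) - v| ∈ Set.Ioc (0 : ℝ) 1 :=
  ⟨abs_pos.2 (sub_ne_zero.2 (Subtype.coe_ne_coe.2 h)),
    Real.dist_le_of_mem_Icc_01 u.2 v.2⟩

theorem IsModulus.holderSeminorm_le_coe_iff {ρ : ℝ → ℝ} (hρ : IsModulus ρ) {K : ℝ≥0}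
    {f : C(I, ℝ)} :
    holderSeminorm ρ f ≤ K ↔ ∀ u v : I, |f u - f v| ≤ K * ρ |(u : ℝ) - v| := by
  simp only [holderSeminorm, iSup_le_iff]
  refine forall₂_congr fun u v => ?_
  rcases eq_or_ne u v with rfl | huv
  · simp only [ne_eq, not_true_eq_false, IsEmpty.forall_iff, sub_self, abs_zero, hρ.map_zero,
      mul_zero, le_refl]
  · rw [← ENNReal.ofReal_coe_nnreal, forall_prop_of_true huv,
      ENNReal.ofReal_le_ofReal_iff K.coe_nonneg,
      div_le_iff₀ (hρ.pos _ (unitInterval_abs_sub_mem_Ioc huv))]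

theorem holderSeminorm_sub_le (ρ : ℝ → ℝ) (f g : C(I, ℝ)) :
    holderSeminorm ρ (f - g) ≤ holderSeminorm ρ f + holderSeminorm ρ g := by
  refine iSup_le fun u => iSup₂_le fun v huv => ?_
  set r := ρ |(u : ℝ) - v|
  have hle : ∀ h : C(I, ℝ), ENNReal.ofReal (|h u - h v| / r) ≤ holderSeminorm ρ h := fun h =>
    le_iSup_of_le u (le_iSup₂_of_le v huv le_rfl)
  refine le_trans ?_ (add_le_add (hle f) (hle g))
  rcases le_total r 0 with hr | hr
  · rw [ENNReal.ofReal_of_nonpos (div_nonpos_of_nonneg_of_nonpos (abs_nonneg _) hr)]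
    exact zero_le
  · rw [← ENNReal.ofReal_add (by positivity) (by positivity), ← add_div]
    gcongr
    rw [ContinuousMap.sub_apply, ContinuousMap.sub_apply, sub_sub_sub_comm]
    exact abs_sub _ _

theorem MuchLarger.exists_forall_holderSeminorm_le {ρ ρs : ℝ → ℝ} (h : MuchLarger ρ ρs)
    (hρ : IsModulus ρ) (hρs : IsModulus ρs) (K : ℝ≥0) {ε : ℝ≥0} (hε : 0 < ε) :
    ∃ η > 0, ∀ f : C(I, ℝ), holderSeminorm ρs f ≤ K → (∀ u, |f u| ≤ η) →
      holderSeminorm ρ f ≤ ε := by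
  obtain ⟨δ, hδ, hclose⟩ : ∃ δ > 0, ∀ x ∈ Set.Ioo 0 δ, ρs x / ρ x < ε / (K + 1) :=
    mem_nhdsGT_iff_exists_Ioo_subset.1 (h.eventually (gt_mem_nhds (by positivity)))
  set d := min δ 1
  have hd01 : d ∈ Set.Ioc (0 : ℝ) 1 := ⟨lt_min hδ one_pos, min_le_right _ _⟩
  have hρd : 0 < ρ d := hρ.pos d hd01
  refine ⟨ε * ρ d / 2, by positivity, fun f hf hsup => hρ.holderSeminorm_le_coe_iff.2 fun u v => ?_⟩
  rcases eq_or_ne u v with rfl | huv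
  · simp [hρ.map_zero]
  have hmem := unitInterval_abs_sub_mem_Ioc huv
  have hpos := hρ.pos _ hmem
  rcases lt_or_ge |(u : ℝ) - v| d with hnear | hfar
  · have hratio := hclose _ ⟨hmem.1, hnear.trans_le (min_le_left _ _)⟩
    rw [div_lt_iff₀ hpos] at hratio
    calc |f u - f v| ≤ K * ρs |(u : ℝ) - v| := hρs.holderSeminorm_le_coe_iff.1 hf u v
      _ ≤ K * (ε / (K + 1) * ρ |(u : ℝ) - v|) := by gcongr
      _ = K / (K + 1) * (ε * ρ |(u : ℝ) - v|) := by ring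
      _ ≤ ε * ρ |(u : ℝ) - v| := mul_le_of_le_one_left (by positivity)
        ((div_le_one (by positivity)).2 (by linarith))
  · calc |f u - f v| ≤ |f u| + |f v| := abs_sub _ _
      _ ≤ ε * ρ d := by linarith [hsup u, hsup v]
      _ ≤ ε * ρ |(u : ℝ) - v| := by
        gcongr
        exact hρ.monotoneOn ⟨hd01.1.le, hd01.2⟩ ⟨hmem.1.le, hmem.2⟩ hfar

theorem IsModulus.exists_finset_forall_abs_le {ρ : ℝ → ℝ} (hρ : IsModulus ρ) {ι : Type*}
    {t : ι → I} (ht : DenseRange t) (K : ℝ≥0) {η : ℝ} (hη : 0 < η) :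
    ∃ s : Finset ι, ∀ f : C(I, ℝ), holderSeminorm ρ f ≤ K →
      (∀ i ∈ s, |f (t i)| ≤ η / 2) → ∀ u, |f u| ≤ η := by
  have hzero : Tendsto (fun x => K * ρ x) (𝓝[Set.Icc 0 1] 0) (𝓝 0) := by
    have h := (hρ.continuousOn 0 ⟨le_rfl, zero_le_one⟩).tendsto.const_mul (K : ℝ)
    rwa [hρ.map_zero, mul_zero] at h
  obtain ⟨r, hr, hsmall⟩ := Metric.mem_nhdsWithin_iff.1
    (hzero.eventually (gt_mem_nhds (half_pos hη)))
  obtain ⟨s, hs⟩ := isCompact_univ.elim_finite_subcover (fun i => Metric.ball (t i) r)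
    (fun _ => Metric.isOpen_ball) fun u _ => Set.mem_iUnion.2 (ht.exists_dist_lt u hr)
  refine ⟨s, fun f hf hfs u => ?_⟩
  obtain ⟨i, hi, hui⟩ := Set.mem_iUnion₂.1 (hs (Set.mem_univ u))
  have hosc : |f u - f (t i)| ≤ η / 2 := by
    refine (hρ.holderSeminorm_le_coe_iff.1 hf u (t i)).trans (le_of_lt (hsmall ⟨?_, ?_⟩))
    · rw [Metric.mem_ball, Real.dist_0_eq_abs, abs_abs]
      exact hui
    · exact ⟨abs_nonneg _, Real.dist_le_of_mem_Icc_01 u.2 (t i).2⟩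
  linarith [abs_sub_abs_le_abs_sub (f u) (f (t i)), hfs i hi]

theorem IsModulus.exists_lt_of_lt_holderSeminorm {ρ : ℝ → ℝ} (hρ : IsModulus ρ) {ι : Type*}
    {t : ι → I} (ht : DenseRange t) {f : C(I, ℝ)} {K : ℝ≥0∞} (hK : K < holderSeminorm ρ f) :
    ∃ i j, t i ≠ t j ∧
      K < ENNReal.ofReal (|f (t i) - f (t j)| / ρ |(t i : ℝ) - (t j : ℝ)|) := by
  simp only [holderSeminorm, lt_iSup_iff] at hK
  obtain ⟨u, v, huv, hK⟩ := hK
  have hmem := unitInterval_abs_sub_mem_Ioc huv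
  have hdist : ContinuousAt (fun p : I × I => ρ |(p.1 : ℝ) - p.2|) (u, v) :=
    (hρ.continuousOn.comp_continuous (f := fun p : I × I => |(p.1 : ℝ) - p.2|) (by fun_prop)
      fun p => ⟨abs_nonneg _, Real.dist_le_of_mem_Icc_01 p.1.2 p.2.2⟩).continuousAt
  have hquot : ContinuousAt (fun p : I × I =>
      ENNReal.ofReal (|f p.1 - f p.2| / ρ |(p.1 : ℝ) - p.2|)) (u, v) :=
    ENNReal.continuous_ofReal.continuousAt.comp
      (ContinuousAt.div (by fun_prop) hdist (hρ.pos _ hmem).ne')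
  have hne : ∀ᶠ p : I × I in 𝓝 (u, v), p.1 ≠ p.2 :=
    isClosed_diagonal.isOpen_compl.mem_nhds huv
  obtain ⟨p, hp⟩ := (ht.prodMap ht).exists_mem_open isOpen_interior ⟨(u, v),
    mem_interior_iff_mem_nhds.2 (hne.and (hquot.eventually (lt_mem_nhds hK)))⟩
  have hp' : Prod.map t t p ∈ {q : I × I | q.1 ≠ q.2 ∧ _} := interior_subset hp
  exact ⟨p.1, p.2, hp'⟩

theorem TendstoFidi.measure_lt_holderSeminorm_le_liminf {Ω : ℕ → Type*} {Ω' : Type*}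
    [∀ n, MeasurableSpace (Ω n)] [MeasurableSpace Ω'] {μ : ∀ n, Measure (Ω n)}
    [∀ n, IsProbabilityMeasure (μ n)] {ν : Measure Ω'} [IsProbabilityMeasure ν]
    {W : ∀ n, Ω n → C(I, ℝ)} {Z : Ω' → C(I, ℝ)} (h : TendstoFidi μ ν W Z) {ρ : ℝ → ℝ}
    (hρ : IsModulus ρ) (K : ℝ≥0∞) :
    ν {ω | K < holderSeminorm ρ (Z ω)} ≤
      liminf (fun n => μ n {ω | K < holderSeminorm ρ (W n ω)}) atTop := by
  let t : ℕ → I := TopologicalSpace.denseSeq I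
  let G : ∀ k, Set (Fin k → ℝ) := fun k => {x | ∃ i j : Fin k, t i ≠ t j ∧
    K < ENNReal.ofReal (|x i - x j| / ρ |(t i : ℝ) - (t j : ℝ)|)}
  have hG : ∀ k, IsOpen (G k) := fun k => by
    simp only [G, Set.ofPred_exists]
    refine isOpen_iUnion fun i => isOpen_iUnion fun j => isOpen_const.and ?_
    exact isOpen_lt continuous_const (ENNReal.continuous_ofReal.comp (by fun_prop))
  have hsub : ∀ k (f : C(I, ℝ)), (fun i : Fin k => f (t i)) ∈ G k → K < holderSeminorm ρ f :=
    fun k f ⟨i, j, hij, hK⟩ => hK.trans_le (le_iSup_of_le (t i) (le_iSup₂_of_le (t j) hij le_rfl))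
  have hmono : Monotone fun k => {ω | (fun i : Fin k => Z ω (t i)) ∈ G k} :=
    fun k l hkl ω ⟨i, j, hij⟩ => ⟨i.castLE hkl, j.castLE hkl, hij⟩
  have hunion : {ω | K < holderSeminorm ρ (Z ω)} ⊆
      ⋃ k, {ω | (fun i : Fin k => Z ω (t i)) ∈ G k} := fun ω hω => by
    obtain ⟨i, j, hij⟩ :=
      hρ.exists_lt_of_lt_holderSeminorm (TopologicalSpace.denseRange_denseSeq I) hω
    exact Set.mem_iUnion.2 ⟨max i j + 1, ⟨i, by omega⟩, ⟨j, by omega⟩, hij⟩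
  refine (measure_mono hunion).trans ?_
  rw [hmono.measure_iUnion]
  refine iSup_le fun k => ?_
  have hfidi := h k fun i => t i
  calc ν {ω | (fun i : Fin k => Z ω (t i)) ∈ G k}
      = ν.map (fun ω (i : Fin k) => Z ω (t i)) (G k) :=
        (Measure.map_apply_of_aemeasurable hfidi.aemeasurable_limit (hG k).measurableSet).symm
    _ ≤ liminf (fun n => (μ n).map (fun ω (i : Fin k) => W n ω (t i)) (G k)) atTop :=
        ProbabilityMeasure.le_liminf_measure_open_of_tendsto hfidi.tendsto (hG k)
    _ ≤ liminf (fun n => μ n {ω | K < holderSeminorm ρ (W n ω)}) atTop := by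
        refine liminf_le_liminf (Eventually.of_forall fun n => ?_)
        rw [Measure.map_apply_of_aemeasurable (hfidi.forall_aemeasurable n) (hG k).measurableSet]
        exact measure_mono fun ω hω => hsub k (W n ω) hω

theorem TendstoBeyond.exists_eventually_measure_lt_le {Ω : ℕ → Type*} {Ω' : Type*}
    [∀ n, MeasurableSpace (Ω n)] [MeasurableSpace Ω'] {μ : ∀ n, Measure (Ω n)}
    [∀ n, IsFiniteMeasure (μ n)] {ν : Measure Ω'} [IsFiniteMeasure ν] {X : ∀ n, Ω n → ℝ}
    {Y : Ω' → ℝ} {τ : ℝ} (h : TendstoBeyond τ μ ν X Y) (hY : Measurable Y) {η : ℝ≥0∞}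
    (hη : 0 < η) : ∃ K : ℝ≥0, ∀ᶠ n in atTop, μ n {ω | K < X n ω} ≤ η := by
  obtain ⟨m, hm, hm0⟩ := (((tendsto_measure_Ici_atTop (ν.map Y)).eventually
    (gt_mem_nhds hη)).and (eventually_ge_atTop 0)).exists
  rw [Measure.map_apply hY measurableSet_Ici] at hm
  have hmono : Monotone fun s : ℝ => ν.real {ω | Y ω ≤ s} := fun s t hst =>
    measureReal_mono fun ω hω => le_trans hω hst
  obtain ⟨t, hcont, ht⟩ := (hmono.countable_not_continuousAt.dense_compl ℝ).exists_mem_open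
    isOpen_Ioi (Set.nonempty_Ioi (a := max τ m))
  obtain ⟨hτt, hmt⟩ := max_lt_iff.1 (Set.mem_Ioi.1 ht)
  refine ⟨⟨t, hm0.trans hmt.le⟩, ?_⟩
  have hlim : Tendsto (fun n => μ n {ω | t < X n ω}) atTop (𝓝 (ν {ω | t < Y ω})) :=
    (ENNReal.tendsto_toReal_iff (fun n => measure_ne_top _ _) (measure_ne_top _ _)).1
      (h t hτt (not_not.1 hcont))
  have hlt : ν {ω | t < Y ω} < η := (measure_mono fun ω hω => (hmt.trans hω).le).trans_lt hm
  exact (hlim.eventually (gt_mem_nhds hlt)).mono fun n hn => hn.le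

theorem TendstoBeyond.exists_eventually_measure_coe_lt_le {Ω : ℕ → Type*} {Ω' : Type*}
    [∀ n, MeasurableSpace (Ω n)] [MeasurableSpace Ω'] {μ : ∀ n, Measure (Ω n)}
    [∀ n, IsFiniteMeasure (μ n)] {ν : Measure Ω'} [IsFiniteMeasure ν] {X : ∀ n, Ω n → ℝ≥0∞}
    {Y : Ω' → ℝ≥0∞} {τ : ℝ}
    (h : TendstoBeyond τ μ ν (fun n ω => (X n ω).toReal) (fun ω => (Y ω).toReal))
    (hX : ∀ n, ∀ᵐ ω ∂μ n, X n ω < ∞) (hY : Measurable Y) {η : ℝ≥0∞} (hη : 0 < η) :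
    ∃ K : ℝ≥0, ∀ᶠ n in atTop, μ n {ω | K < X n ω} ≤ η := by
  obtain ⟨K, hK⟩ := h.exists_eventually_measure_lt_le hY.ennreal_toReal hη
  refine ⟨K, hK.mono fun n hn => (measure_mono_ae ?_).trans hn⟩
  filter_upwards [hX n] with ω hω hKω
  exact (ENNReal.toReal_lt_toReal ENNReal.coe_ne_top hω.ne).2 hKω

theorem tendsto_measure_lt_holderSeminorm_sub {α S ι : Type*} {l : Filter α} [MeasurableSpace S]
    {R : Measure S} {X : α → S → C(I, ℝ)} {Y : S → C(I, ℝ)} {ρs : ℝ → ℝ} (hρs : IsModulus ρs)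
    {t : ι → I} (ht : DenseRange t)
    (hXY : ∀ i, TendstoInMeasure R (fun a s => X a s (t i)) l (fun s => Y s (t i)))
    (htight : ∀ η : ℝ≥0∞, 0 < η → ∃ K : ℝ≥0, R {s | K < holderSeminorm ρs (Y s)} ≤ η ∧
      ∀ᶠ a in l, R {s | K < holderSeminorm ρs (X a s)} ≤ η)
    {ρ : ℝ → ℝ} (hρ : IsModulus ρ) (hρρs : MuchLarger ρ ρs) {ε : ℝ≥0∞} (hε : 0 < ε) :
    Tendsto (fun a => R {s | ε < holderSeminorm ρ (X a s - Y s)}) l (𝓝 0) := by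
  obtain ⟨ε', hε', hε'ε⟩ := ENNReal.lt_iff_exists_nnreal_btwn.1 hε
  refine ENNReal.tendsto_nhds_zero.2 fun θ hθ => ?_
  have hθ3 : 0 < θ / 3 := ENNReal.div_pos hθ.ne' (by finiteness)
  obtain ⟨K, hYK, hXK⟩ := htight (θ / 3) hθ3
  obtain ⟨η, hη, hsup⟩ :=
    hρρs.exists_forall_holderSeminorm_le hρ hρs (K + K) (ENNReal.coe_pos.1 hε')
  obtain ⟨s, hs⟩ := hρs.exists_finset_forall_abs_le ht (K + K) hη
  have hfar : Tendsto (fun a => ∑ i ∈ s, R {x | η / 2 ≤ dist (X a x (t i)) (Y x (t i))})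
      l (𝓝 0) := by
    simpa using tendsto_finsetSum s fun i _ => tendstoInMeasure_iff_dist.1 (hXY i) _ (half_pos hη)
  filter_upwards [hXK, ENNReal.tendsto_nhds_zero.1 hfar _ hθ3] with a ha hdn
  have hsub : {x | ε < holderSeminorm ρ (X a x - Y x)} ⊆
      {x | K < holderSeminorm ρs (X a x)} ∪ {x | K < holderSeminorm ρs (Y x)} ∪
        ⋃ i ∈ s, {x | η / 2 ≤ dist (X a x (t i)) (Y x (t i))} := by
    intro x hx
    by_contra hcon
    simp only [Set.mem_union, Set.mem_iUnion₂, Set.mem_ofPred_eq, not_or, not_exists,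
      not_lt, not_le] at hcon
    obtain ⟨⟨hXx, hYx⟩, hnear⟩ := hcon
    have hK : holderSeminorm ρs (X a x - Y x) ≤ (K + K : ℝ≥0) :=
      (holderSeminorm_sub_le ρs _ _).trans
        ((add_le_add hXx hYx).trans_eq (ENNReal.coe_add K K).symm)
    exact (hsup _ hK (hs _ hK fun i hi => (hnear i hi).le)).not_gt (hε'ε.trans hx)
  calc R {x | ε < holderSeminorm ρ (X a x - Y x)} ≤ θ / 3 + θ / 3 + θ / 3 :=
        (measure_mono hsub).trans <| (measure_union_le _ _).trans <| add_le_add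
          ((measure_union_le _ _).trans (add_le_add ha hYK))
          ((measure_biUnion_finset_le s _).trans hdn)
    _ = θ := ENNReal.add_thirds θ

theorem tendstoInDistribution_map {α E F : Type*} {l : Filter α} {Ω : α → Type*} {Ω' : Type*}
    [∀ a, MeasurableSpace (Ω a)] [MeasurableSpace Ω'] {μ : ∀ a, Measure (Ω a)}
    [∀ a, IsProbabilityMeasure (μ a)] {ν : Measure Ω'} [IsProbabilityMeasure ν]
    [MeasurableSpace E] [TopologicalSpace F] [MeasurableSpace F] [OpensMeasurableSpace F]
    {W : ∀ a, Ω a → E} {Z : Ω' → E} (hW : ∀ a, AEMeasurable (W a) (μ a)) (hZ : AEMeasurable Z ν)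
    [∀ a, IsProbabilityMeasure ((μ a).map (W a))] [IsProbabilityMeasure (ν.map Z)] {g : E → F}
    (hg : Measurable g)
    (h : TendstoInDistribution (fun a ω => g (W a ω)) l (fun ω => g (Z ω)) μ ν) :
    TendstoInDistribution (fun _ => g) l g (fun a => (μ a).map (W a)) (ν.map Z) where
  forall_aemeasurable _ := hg.aemeasurable
  aemeasurable_limit := hg.aemeasurable
  tendsto := by
    simpa only [AEMeasurable.map_map_of_aemeasurable hg.aemeasurable (hW _),
      AEMeasurable.map_map_of_aemeasurable hg.aemeasurable hZ, Function.comp_def] using h.tendsto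

theorem theorem7_general [MeasurableSpace C(I, ℝ)] [BorelSpace C(I, ℝ)]
    {Ω : ℕ → Type*} {Ω' : Type*} [∀ n, MeasurableSpace (Ω n)] [MeasurableSpace Ω']
    (μ : ∀ n, Measure (Ω n)) [∀ n, IsProbabilityMeasure (μ n)]
    (ν : Measure Ω') [IsProbabilityMeasure ν]
    (W : ∀ n, Ω n → C(I, ℝ)) (hW : ∀ n, Measurable (W n))
    (Z : Ω' → C(I, ℝ)) (hZ : Measurable Z)
    (ρs : ℝ → ℝ) (hρs : IsModulus ρs)
    (hfidi : TendstoFidi μ ν W Z)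
    (htight : ∀ η : ℝ≥0∞, 0 < η →
      ∃ K : ℝ≥0, ∀ᶠ n in atTop, μ n {ω | K < holderSeminorm ρs (W n ω)} ≤ η) :
    ∃ (S : Type) (_ : MeasurableSpace S) (P : Measure S) (_ : IsProbabilityMeasure P)
      (W' : ℕ → S → C(I, ℝ)) (Z' : S → C(I, ℝ)),
      (∀ n, Measurable (W' n)) ∧ Measurable Z' ∧
      (∀ n, P.map (W' n) = (μ n).map (W n)) ∧ P.map Z' = ν.map Z ∧
      ∀ ρ : ℝ → ℝ, IsModulus ρ → MuchLarger ρ ρs →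
        ∀ ε : ℝ≥0∞, 0 < ε →
          Tendsto (fun n => P {ω | ε < holderSeminorm ρ (W' n ω - Z' ω)}) atTop (𝓝 0) := by
  have hWP : ∀ n, IsProbabilityMeasure ((μ n).map (W n)) := fun n =>
    Measure.isProbabilityMeasure_map (hW n).aemeasurable
  have hZP : IsProbabilityMeasure (ν.map Z) := Measure.isProbabilityMeasure_map hZ.aemeasurable
  let t : ℕ → I := TopologicalSpace.denseSeq I
  have heval : ∀ i, Measurable fun f : C(I, ℝ) => f (t i) := fun i =>
    (ContinuousEvalConst.continuous_eval_const (t i)).measurable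
  obtain ⟨W', Z', hW', hZ', hWlaw, hZlaw, hconv⟩ := exists_measurable_map_eq_tendstoInMeasure
    heval fun k => tendstoInDistribution_map (fun n => (hW n).aemeasurable) hZ.aemeasurable
      (measurable_pi_lambda _ fun i => heval i) (hfidi k fun i => t i)
  refine ⟨_, _, _, inferInstance, W', Z', hW', hZ', hWlaw, hZlaw,
    fun ρ hρ hρρs ε hε => ?_⟩
  refine tendsto_measure_lt_holderSeminorm_sub hρs (TopologicalSpace.denseRange_denseSeq I) hconv
    (fun η hη => ?_) hρ hρρs hε
  obtain ⟨K, hK⟩ := htight η hη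
  have hidW := fun n => (IdentDistrib.mk (hW' n).aemeasurable (hW n).aemeasurable
    (hWlaw n)).measure_mem_eq (measurableSet_lt_holderSeminorm ρs K)
  have hidZ := (IdentDistrib.mk hZ'.aemeasurable hZ.aemeasurable hZlaw).measure_mem_eq
    (measurableSet_lt_holderSeminorm ρs K)
  refine ⟨K, hidZ.le.trans ?_, hK.mono fun n hn => (hidW n).le.trans hn⟩
  exact (hfidi.measure_lt_holderSeminorm_le_liminf hρs K).trans
    (liminf_le_of_frequently_le' hK.frequently)

theorem theorem7 [MeasurableSpace C(I, ℝ)] [BorelSpace C(I, ℝ)]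
    {Ω : ℕ → Type*} {Ω' : Type*} [∀ n, MeasurableSpace (Ω n)] [MeasurableSpace Ω']
    (μ : ∀ n, Measure (Ω n)) [∀ n, IsProbabilityMeasure (μ n)]
    (ν : Measure Ω') [IsProbabilityMeasure ν]
    (W : ∀ n, Ω n → C(I, ℝ)) (hW : ∀ n, Measurable (W n))
    (Z : Ω' → C(I, ℝ)) (hZ : Measurable Z)
    (ρs : ℝ → ℝ) (hρs : IsModulus ρs)
    (hfidi : TendstoFidi μ ν W Z)
    (hWfin : ∀ n, ∀ᵐ ω ∂(μ n), holderSeminorm ρs (W n ω) < ∞)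
    (hZfin : ∀ᵐ ω ∂ν, holderSeminorm ρs (Z ω) < ∞)
    (T : ℝ)
    (hT : TendstoBeyond T μ ν (fun n ω => (holderSeminorm ρs (W n ω)).toReal)
      (fun ω => (holderSeminorm ρs (Z ω)).toReal)) :
    ∃ (S : Type) (_ : MeasurableSpace S) (P : Measure S) (_ : IsProbabilityMeasure P)
      (W' : ℕ → S → C(I, ℝ)) (Z' : S → C(I, ℝ)),
      (∀ n, Measurable (W' n)) ∧ Measurable Z' ∧
      (∀ n, P.map (W' n) = (μ n).map (W n)) ∧ P.map Z' = ν.map Z ∧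
      ∀ ρ : ℝ → ℝ, IsModulus ρ → MuchLarger ρ ρs →
        ∀ ε : ℝ≥0∞, 0 < ε →
          Tendsto (fun n => P {ω | ε < holderSeminorm ρ (W' n ω - Z' ω)}) atTop (𝓝 0) :=
  theorem7_general μ ν W hW Z hZ ρs hρs hfidi fun _ hη =>
    hT.exists_eventually_measure_coe_lt_le hWfin
      ((lowerSemicontinuous_holderSeminorm ρs).measurable.comp hZ) hη
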